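/- Let $d\in\mathbb N$ and $a,b>0$. Write $\mathcal M(\mathbb R^d)$ for the set of finite positive Borel measures on $\mathbb R^d$ and $\mathcal M^s(\mathbb R^d)$ for the set of finite signed Borel measures. For $\sigma\in\mathcal M^s(\mathbb R^d)$ let $|\sigma|$ be its total mass, i.e. the sum of the masses of its two Jordan parts. For $\mu,\nu\in\mathcal M(\mathbb R^d)$ put $$W_1^{a,b}(\mu,\nu)=\inf\big\{a(|\mu-\tilde\mu|+|\nu-\tilde\nu|)+b\,W_1(\tilde\mu,\tilde\nu)\ :\ \tilde\mu,\tilde\nu\in\mathcal M(\mathbb R^d),\ |\tilde\mu|=|\tilde\nu|\big\},$$ where $W_1(\tilde\mu,\tilde\nu)=\inf_\pi\int|x-y|\,d\pi(x,y)\in[0,\infty]$ over all positive measures $\pi$ on $\mathbb R^d\times\mathbb R^d$ with marginals $\tilde\mu$ and $\tilde\nu$. For $\sigma\in\mathcal M^s(\mathbb R^d)$ with Jordan decomposition $\sigma=\sigma^+-\sigma^-$ put $\|\sigma\|^{a,b}=W_1^{a,b}(\sigma^+,\sigma^-)$. Theorem 30. Let $\mu_n$ ($n\in\mathbb N$) and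 $\mu$ be in $\mathcal M^s(\mathbb R^d)$, let $\mu=\mu^+-\mu^-$ be the Jordan decomposition of $\mu$, and for each $n$ let $\mu_n=\mu_n^+-\mu_n^-$ be any decomposition with $\mu_n^+,\mu_n^-\in\mathcal M(\mathbb R^d)$ (not necessarily the Jordan decomposition). Then the following two statements are equivalent: (i) $\|\mu_n-\mu\|^{a,b}\to0$ as $n\to\infty$. (ii) There exist $z_n^+,z_n^-,m_n^+,m_n^-\in\mathcal M(\mathbb R^d)$ ($n\in\mathbb N$) such that, for all $n$, $\mu_n^+=z_n^++m_n^+$ and $\mu_n^-=z_n^-+m_n^-$; moreover $W_1^{a,b}(z_n^+,z_n^-)\to0$, $W_1^{a,b}(m_n^+,\mu^+)\to0$ and $W_1^{a,b}(m_n^-,\mu^-)\to0$ as $n\to\infty$; and each of the sequences $(m_n^+)_n$ and $(m_n^-)_n$ is tight (for every $\varepsilon>0$ there is a compact set $K\subset\mathbb R^d$ such that each measure of the sequence gives $\mathbb R^d\setminus K$ mass less than $\varepsilon$) and bounded in mass. -/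

import Mathlib

open MeasureTheory Filter Topology
open scoped ENNReal NNReal

namespace GenWasserstein

noncomputable section

/-- The finite signed measure `μ - ν` for finite positive measures `μ`, `ν` on `ℝᵈ`. -/
def diff {d : ℕ} (μ ν : FiniteMeasure (EuclideanSpace ℝ (Fin d))) :
    SignedMeasure (EuclideanSpace ℝ (Fin d)) :=
  (μ : Measure (EuclideanSpace ℝ (Fin d))).toSignedMeasure -
    (ν : Measure (EuclideanSpace ℝ (Fin d))).toSignedMeasure

/-- Positive part of the Jordan decomposition of a finite signed measure. -/
def jordanPos {d : ℕ} (μ : SignedMeasure (EuclideanSpace ℝ (Fin d))) :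
    FiniteMeasure (EuclideanSpace ℝ (Fin d)) :=
  ⟨μ.toJordanDecomposition.posPart, μ.toJordanDecomposition.posPart_finite⟩

/-- Negative part of the Jordan decomposition of a finite signed measure. -/
def jordanNeg {d : ℕ} (μ : SignedMeasure (EuclideanSpace ℝ (Fin d))) :
    FiniteMeasure (EuclideanSpace ℝ (Fin d)) :=
  ⟨μ.toJordanDecomposition.negPart, μ.toJordanDecomposition.negPart_finite⟩

/-- The total mass `|μ|` of a finite signed measure: the sum of the masses of its two Jordan
parts. -/
def tvMass {d : ℕ} (μ : SignedMeasure (EuclideanSpace ℝ (Fin d))) : ℝ≥0∞ :=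
  μ.totalVariation Set.univ

/-- `π` is a transference plan from `μ` to `ν`: its marginals are `μ` and `ν`. -/
def IsTransferencePlan {d : ℕ} (μ ν : FiniteMeasure (EuclideanSpace ℝ (Fin d)))
    (π : Measure (EuclideanSpace ℝ (Fin d) × EuclideanSpace ℝ (Fin d))) : Prop :=
  π.fst = (μ : Measure (EuclideanSpace ℝ (Fin d))) ∧
    π.snd = (ν : Measure (EuclideanSpace ℝ (Fin d)))

/-- The Wasserstein distance `W₁(μ, ν)` of two finite measures of the same mass: the infimum of
`∫ |x - y| dπ(x, y)` over all transference plans. It may be `∞`, as first moments are not assumed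
to be finite. -/
def W1 {d : ℕ} (μ ν : FiniteMeasure (EuclideanSpace ℝ (Fin d))) : ℝ≥0∞ :=
  ⨅ (π : Measure (EuclideanSpace ℝ (Fin d) × EuclideanSpace ℝ (Fin d)))
    (_ : IsTransferencePlan μ ν π), ∫⁻ p, edist p.1 p.2 ∂π

/-- The generalized Wasserstein distance `W₁^{a,b}(μ, ν)` of two finite positive measures. -/
def W1ab {d : ℕ} (a b : ℝ) (μ ν : FiniteMeasure (EuclideanSpace ℝ (Fin d))) : ℝ≥0∞ :=
  ⨅ (μ' : FiniteMeasure (EuclideanSpace ℝ (Fin d)))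
    (ν' : FiniteMeasure (EuclideanSpace ℝ (Fin d))) (_ : μ'.mass = ν'.mass),
    ENNReal.ofReal a * (tvMass (diff μ μ') + tvMass (diff ν ν')) +
      ENNReal.ofReal b * W1 μ' ν'

/-- The generalized Wasserstein distance of two finite signed measures,
`W₁^{a,b}(μ₊ + ν₋, μ₋ + ν₊)`, computed with the Jordan decompositions. -/
def signedW1ab {d : ℕ} (a b : ℝ) (μ ν : SignedMeasure (EuclideanSpace ℝ (Fin d))) : ℝ≥0∞ :=
  W1ab a b (jordanPos μ + jordanNeg ν) (jordanNeg μ + jordanPos ν)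

/-- The norm `‖μ‖^{a,b}`, the generalized Wasserstein distance of `μ` from `0`. -/
def normab {d : ℕ} (a b : ℝ) (μ : SignedMeasure (EuclideanSpace ℝ (Fin d))) : ℝ≥0∞ :=
  signedW1ab a b μ 0

/-- Tightness of a sequence of finite positive measures. -/
def IsTightSeq {d : ℕ} (m : ℕ → FiniteMeasure (EuclideanSpace ℝ (Fin d))) : Prop :=
  IsTightMeasureSet (Set.range fun n => (m n : Measure (EuclideanSpace ℝ (Fin d))))

/-- A sequence of finite positive measures is bounded in mass. -/
def IsBoundedInMass {d : ℕ} (m : ℕ → FiniteMeasure (EuclideanSpace ℝ (Fin d))) : Prop :=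
  ∃ C : ℝ≥0, ∀ n, (m n).mass ≤ C

end

end GenWasserstein

namespace GenWasserstein

open ProbabilityTheory Set

/-! ### Densities, sub-Markov kernels and composed measures -/

section Prelim

variable {X : Type*} [MeasurableSpace X]

/-! `W1ab a b μ ν` is small exactly when some partial plan from `μ` to `ν` is cheap and leaves
little mass untouched; `Near` measures this by one number. It is symmetric and additive, and it
obeys a triangle inequality by gluing (`Near.trans`).

The main difficulty is cancellation (`Near.cancel`): a common summand `r` may be removed from both
sides at the price of a factor 3. Hence smallness depends only on the difference of the two
measures, and `‖μₙ - μ‖ → 0` says that there are good partial plans from `μₙ⁺ + μ⁻` to `μₙ⁻ + μ⁺`,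
whatever the decomposition of `μₙ`.

For (i) ⇒ (ii), such a plan is cut into four blocks (`Near.exists_split`). The block from `μₙ⁺` to
`μ⁺` starts from `mₙ⁺`, the block from `μ⁻` to `μₙ⁻` ends in `mₙ⁻`, and the block from `μₙ⁺` to
`μₙ⁻` compares the remainders `zₙ⁺`, `zₙ⁻`. The fourth block, from `μ⁻` to `μ⁺`, is the only
obstacle: its mass vanishes in the limit because its cost does and `μ⁻ ⟂ μ⁺`
(`tendsto_plan_univ_of_mutuallySingular`). Tightness follows from nearness to a fixed measure, and
the mass bounds from the marginals of the blocks. For (ii) ⇒ (i), three partial plans are added. -/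

lemma exists_density_of_le {π ν : Measure X} [IsFiniteMeasure ν] (h : π ≤ ν) :
    ∃ f : X → ℝ≥0∞, Measurable f ∧ (∀ x, f x ≤ 1) ∧ ν.withDensity f = π := by
  have : IsFiniteMeasure π := isFiniteMeasure_of_le ν h
  -- The derivative is at most 1 only almost everywhere; truncating makes the bound hold at every
  -- point.
  refine ⟨fun x => min (π.rnDeriv ν x) 1, (π.measurable_rnDeriv ν).min measurable_const,
    fun x => min_le_right _ _, ?_⟩
  have hac : π ≪ ν := Measure.absolutelyContinuous_of_le h
  rw [← Measure.withDensity_rnDeriv_eq π ν hac]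
  refine withDensity_congr_ae ?_
  filter_upwards [Measure.rnDeriv_le_one_of_le h] with x hx
  rw [Measure.withDensity_rnDeriv_eq π ν hac]
  exact min_eq_left hx

lemma withDensity_mono_measure' {μ ν : Measure X} (h : μ ≤ ν) (f : X → ℝ≥0∞) :
    μ.withDensity f ≤ ν.withDensity f := by
  refine Measure.le_iff.2 fun s hs => ?_
  rw [withDensity_apply _ hs, withDensity_apply _ hs]
  exact lintegral_mono' (Measure.restrict_mono le_rfl h) le_rfl

lemma withDensity_add_of_add_eq_one (μ : Measure X) {f g : X → ℝ≥0∞} (hf : Measurable f)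
    (hfg : ∀ x, f x + g x = 1) : μ.withDensity f + μ.withDensity g = μ := by
  rw [← withDensity_add_left hf]
  have : f + g = 1 := funext hfg
  rw [this, withDensity_one]

lemma exists_density_add (q r : Measure X) [IsFiniteMeasure q] [IsFiniteMeasure r] :
    ∃ f g : X → ℝ≥0∞, Measurable f ∧ Measurable g ∧ (∀ x, f x + g x = 1) ∧
      (q + r).withDensity f = q ∧ (q + r).withDensity g = r := by
  obtain ⟨f, hf, hf1, hfq⟩ := exists_density_of_le (Measure.le_add_right (le_refl q) : q ≤ q + r)
  have hfg : ∀ x, f x + (1 - f x) = 1 := fun x => add_tsub_cancel_of_le (hf1 x)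
  refine ⟨f, fun x => 1 - f x, hf, measurable_const.sub hf, hfg, hfq, ?_⟩
  have := withDensity_add_of_add_eq_one (q + r) hf hfg
  rw [hfq] at this
  ext s hs
  have h2 := congrArg (fun m : Measure X => m s) this
  simp only [Measure.add_apply] at h2
  exact (ENNReal.add_right_inj (measure_ne_top q s)).1 h2

lemma bind_mono_measure {Y : Type*} [MeasurableSpace Y] {μ ν : Measure X} (h : μ ≤ ν)
    (κ : Kernel X Y) : μ.bind κ ≤ ν.bind κ := by
  refine Measure.le_iff.2 fun s hs => ?_
  rw [Measure.bind_apply hs κ.aemeasurable, Measure.bind_apply hs κ.aemeasurable]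
  exact lintegral_mono' h le_rfl

lemma bind_univ_le {Y : Type*} [MeasurableSpace Y] (μ : Measure X) {κ : Kernel X Y}
    (hκ : ∀ x, κ x univ ≤ 1) : (μ.bind κ) univ ≤ μ univ := by
  rw [Measure.bind_apply .univ κ.aemeasurable]
  exact (lintegral_mono hκ).trans (by simp)

/-- Disintegrate `π` over its first marginal and multiply the conditional kernel at `x` by the
density of that marginal with respect to `ν`. The mass missing from `κ x` is the fraction of `ν` at
`x` that `π` leaves in place. -/
lemma exists_subkernel [StandardBorelSpace X] [Nonempty X] {π : Measure (X × X)}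
    {ν : Measure X} [IsFiniteMeasure ν] (h : π.fst ≤ ν) :
    ∃ κ : Kernel X X, IsFiniteKernel κ ∧ (∀ x, κ x univ ≤ 1) ∧ ν ⊗ₘ κ = π := by
  have hfin : IsFiniteMeasure π.fst := isFiniteMeasure_of_le ν h
  have : IsFiniteMeasure π := ⟨by rw [← Measure.fst_univ]; exact measure_lt_top _ _⟩
  obtain ⟨f, hf, hf1, hfπ⟩ := exists_density_of_le h
  let κ : Kernel X X := Kernel.withDensity π.condKernel fun x _ => f x
  have hfm : Measurable (Function.uncurry fun (x : X) (_ : X) => f x) := hf.comp measurable_fst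
  have hκ : ∀ x, κ x = f x • π.condKernel x := fun x => by
    rw [Kernel.withDensity_apply _ hfm, withDensity_const]
  have hκ1 : ∀ x, κ x univ ≤ 1 := fun x => by
    rw [hκ, Measure.smul_apply, measure_univ]; simpa using hf1 x
  refine ⟨κ, ⟨1, by simp, hκ1⟩, hκ1, ?_⟩
  have : IsFiniteKernel κ := ⟨1, by simp, hκ1⟩
  conv_rhs => rw [← π.disintegrate π.condKernel]
  ext s hs
  rw [Measure.compProd_apply hs, Measure.compProd_apply hs, ← hfπ,
    lintegral_withDensity_eq_lintegral_mul _ hf (Kernel.measurable_kernel_prodMk_left hs)]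
  simp [hκ]

lemma add_le_mul_add_one {s t : ℝ≥0∞} (hs : s ≤ 1) (ht : t ≤ 1) : s + t ≤ s * t + 1 := by
  lift s to ℝ≥0 using ne_top_of_le_ne_top ENNReal.one_ne_top hs
  lift t to ℝ≥0 using ne_top_of_le_ne_top ENNReal.one_ne_top ht
  norm_cast at *
  have hs' : (s : ℝ) ≤ 1 := hs
  have ht' : (t : ℝ) ≤ 1 := ht
  have : (s : ℝ) + t ≤ s * t + 1 := by nlinarith
  exact this

lemma lintegral_bind_prod {ν : Measure X} {κ₁ κ₂ : Kernel X X} [IsFiniteKernel κ₁]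
    [IsFiniteKernel κ₂] {f : X × X → ℝ≥0∞} (hf : Measurable f) :
    ∫⁻ p, f p ∂(ν.bind (κ₁ ×ₖ κ₂)) = ∫⁻ y, ∫⁻ x, ∫⁻ z, f (x, z) ∂κ₂ y ∂κ₁ y ∂ν := by
  rw [Measure.lintegral_bind (Kernel.aemeasurable _) hf.aemeasurable]
  refine lintegral_congr fun y => ?_
  rw [Kernel.prod_apply, lintegral_prod _ hf.aemeasurable]

end Prelim

/-! ### Nearness through partial plans, and its triangle inequality -/

section Near

variable {X : Type*} [MetricSpace X] [MeasurableSpace X]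

/-- Some partial transference plan from `μ` to `ν` leaves untouched a total mass which, added to
the transport cost, is at most `c`. -/
def Near (μ ν : Measure X) (c : ℝ≥0∞) : Prop :=
  ∃ π : Measure (X × X), π.fst ≤ μ ∧ π.snd ≤ ν ∧
    μ univ + ν univ + ∫⁻ p, edist p.1 p.2 ∂π ≤ 2 * π univ + c

lemma Near.mono {μ ν : Measure X} {c c' : ℝ≥0∞} (h : Near μ ν c) (hc : c ≤ c') :
    Near μ ν c' := by
  obtain ⟨π, h1, h2, h3⟩ := h
  exact ⟨π, h1, h2, h3.trans (by gcongr)⟩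

lemma near_of_univ_add (μ ν : Measure X) : Near μ ν (μ univ + ν univ) :=
  ⟨0, by simp [Measure.zero_le], by simp [Measure.zero_le], by simp⟩

lemma Near.add {μ ν μ' ν' : Measure X} {c c' : ℝ≥0∞} (h : Near μ ν c) (h' : Near μ' ν' c') :
    Near (μ + μ') (ν + ν') (c + c') := by
  obtain ⟨π, h1, h2, h3⟩ := h
  obtain ⟨π', h1', h2', h3'⟩ := h'
  refine ⟨π + π', ?_, ?_, ?_⟩
  · rw [Measure.fst_add]; gcongr
  · rw [Measure.snd_add]; gcongr
  · simp only [Measure.add_apply, lintegral_add_measure]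
    calc _ = (μ univ + ν univ + ∫⁻ p, edist p.1 p.2 ∂π) +
          (μ' univ + ν' univ + ∫⁻ p, edist p.1 p.2 ∂π') := by ring
      _ ≤ _ := add_le_add h3 h3'
      _ = _ := by ring

lemma Near.univ_le {μ ν : Measure X} [IsFiniteMeasure ν] {c : ℝ≥0∞} (h : Near μ ν c) :
    μ univ ≤ ν univ + c := by
  obtain ⟨π, h1, h2, h3⟩ := h
  have hπ : π univ ≤ ν univ := by rw [← Measure.snd_univ]; exact h2 univ
  refine (ENNReal.add_le_add_iff_left (measure_ne_top ν univ)).1 ?_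
  calc _ = μ univ + ν univ := add_comm _ _
    _ ≤ _ := le_self_add
    _ ≤ _ := h3
    _ ≤ 2 * ν univ + c := by gcongr
    _ = _ := by ring

variable [SecondCountableTopology X] [BorelSpace X]

lemma Near.symm {μ ν : Measure X} {c : ℝ≥0∞} (h : Near μ ν c) : Near ν μ c := by
  obtain ⟨π, h1, h2, h3⟩ := h
  refine ⟨π.map Prod.swap, by rwa [Measure.fst_map_swap], by rwa [Measure.snd_map_swap], ?_⟩
  rw [lintegral_map (by fun_prop) measurable_swap, Measure.map_apply measurable_swap .univ]
  simpa [edist_comm, add_comm (ν univ)] using h3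

lemma near_of_le {μ ν : Measure X} [IsFiniteMeasure ν] (h : μ ≤ ν) :
    Near μ ν (ν univ - μ univ) := by
  have hm : Measurable fun x : X => (x, x) := by fun_prop
  have h1 : (μ.map fun x => (x, x)).fst = μ := by
    rw [Measure.fst, Measure.map_map measurable_fst hm]; exact Measure.map_id
  have h2 : (μ.map fun x => (x, x)).snd = μ := by
    rw [Measure.snd, Measure.map_map measurable_snd hm]; exact Measure.map_id
  refine ⟨μ.map fun x => (x, x), h1.le, h2.le.trans h, ?_⟩
  rw [lintegral_map (by fun_prop) hm, Measure.map_apply hm .univ]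
  simp only [edist_self, lintegral_zero, preimage_univ, add_zero]
  rw [two_mul, add_assoc, add_tsub_cancel_of_le (h univ)]

lemma Near.refl (μ : Measure X) [IsFiniteMeasure μ] : Near μ μ 0 := by
  simpa using near_of_le (le_refl μ)

variable [StandardBorelSpace X]

/-- Both plans are written as subkernels started from the middle measure `ν` and run independently
given the middle point. Only mass of `ν` used by both plans survives, which is why the defect counts
untouched mass as well as cost. -/
lemma Near.trans {μ ν ρ : Measure X} [IsFiniteMeasure ν] {c c' : ℝ≥0∞} (h : Near μ ν c)
    (h' : Near ν ρ c') : Near μ ρ (c + c') := by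
  rcases isEmpty_or_nonempty X with hX | hX
  · exact ⟨0, by simp, by simp, by simp [univ_eq_empty_iff.2 hX]⟩
  obtain ⟨π₁, h1, h2, h3⟩ := h
  obtain ⟨π₂, h1', h2', h3'⟩ := h'
  obtain ⟨κ₁, hf1, hκ1, hπ1⟩ := exists_subkernel (π := π₁.map Prod.swap) (ν := ν)
    (by rwa [Measure.fst_map_swap])
  obtain ⟨κ₂, hf2, hκ2, hπ2⟩ := exists_subkernel h1'
  set γ := ν.bind (κ₁ ×ₖ κ₂)
  have hγ : ∀ s t : Set X, MeasurableSet s → MeasurableSet t →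
      γ (s ×ˢ t) = ∫⁻ y, κ₁ y s * κ₂ y t ∂ν := fun s t hs ht => by
    rw [Measure.bind_apply (hs.prod ht) (Kernel.aemeasurable _)]
    simp [Kernel.prod_apply]
  have hm1 : ∀ s, MeasurableSet s → π₁ (s ×ˢ univ) = ∫⁻ y, κ₁ y s ∂ν := fun s hs => by
    have : π₁ = (ν ⊗ₘ κ₁).map Prod.swap := by
      rw [hπ1, Measure.map_map measurable_swap measurable_swap]; simp
    rw [this, Measure.map_apply measurable_swap (hs.prod .univ), preimage_swap_prod,
      Measure.compProd_apply_prod .univ hs]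
    simp
  have hm2 : ∀ s, MeasurableSet s → π₂ (univ ×ˢ s) = ∫⁻ y, κ₂ y s ∂ν := fun s hs => by
    rw [← hπ2, Measure.compProd_apply_prod .univ hs]
    simp
  -- Pointwise this is `(1 - s) * (1 - t) ≥ 0`: the mass lost in gluing is at most what the two
  -- plans leave untouched in `ν`.
  have hmass : π₁ univ + π₂ univ ≤ γ univ + ν univ := by
    rw [← univ_prod_univ, hγ _ _ .univ .univ, hm1 _ .univ, hm2 _ .univ,
      ← lintegral_add_left (κ₁.measurable_coe .univ), ← lintegral_one,
      ← lintegral_add_right _ measurable_const]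
    exact lintegral_mono fun y => add_le_mul_add_one (hκ1 y) (hκ2 y)
  have hcost : ∫⁻ p, edist p.1 p.2 ∂γ ≤
      ∫⁻ p, edist p.1 p.2 ∂π₁ + ∫⁻ p, edist p.1 p.2 ∂π₂ := by
    have e1 : ∫⁻ p, edist p.1 p.2 ∂π₁ = ∫⁻ y, ∫⁻ x, edist x y ∂κ₁ y ∂ν := by
      have : ∫⁻ p, edist p.1 p.2 ∂π₁ = ∫⁻ p, edist p.2 p.1 ∂(ν ⊗ₘ κ₁) := by
        rw [hπ1, lintegral_map (by fun_prop) measurable_swap]; simp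
      rw [this, Measure.lintegral_compProd (by fun_prop)]
    have e2 : ∫⁻ p, edist p.1 p.2 ∂π₂ = ∫⁻ y, ∫⁻ z, edist y z ∂κ₂ y ∂ν := by
      rw [← hπ2, Measure.lintegral_compProd (by fun_prop)]
    rw [lintegral_bind_prod (by fun_prop), e1, e2, ← lintegral_add_left]
    · refine lintegral_mono fun y => ?_
      calc ∫⁻ x, ∫⁻ z, edist x z ∂κ₂ y ∂κ₁ y
          ≤ ∫⁻ x, ∫⁻ z, (edist x y + edist y z) ∂κ₂ y ∂κ₁ y := by
            gcongr; exact edist_triangle _ _ _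
        _ = ∫⁻ x, (edist x y * κ₂ y univ + ∫⁻ z, edist y z ∂κ₂ y) ∂κ₁ y := by
            refine lintegral_congr fun x => ?_
            rw [lintegral_add_left measurable_const, lintegral_const]
        _ ≤ ∫⁻ x, (edist x y + ∫⁻ z, edist y z ∂κ₂ y) ∂κ₁ y := by
            gcongr with x; exact mul_le_of_le_one_right' (hκ2 y)
        _ = ∫⁻ x, edist x y ∂κ₁ y + (∫⁻ z, edist y z ∂κ₂ y) * κ₁ y univ := by
            rw [lintegral_add_right _ measurable_const, lintegral_const]
        _ ≤ _ := by gcongr; exact mul_le_of_le_one_right' (hκ1 y)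
    · exact Measurable.lintegral_kernel_prod_right' (f := fun p : X × X => edist p.2 p.1)
        (by fun_prop)
  refine ⟨γ, ?_, ?_, ?_⟩
  · refine le_trans (Measure.le_iff.2 fun s hs => ?_) h1
    rw [Measure.fst_apply hs, Measure.fst_apply hs, ← prod_univ, hγ _ _ hs .univ, hm1 _ hs]
    exact lintegral_mono fun y => mul_le_of_le_one_right' (hκ2 y)
  · refine le_trans (Measure.le_iff.2 fun s hs => ?_) h2'
    rw [Measure.snd_apply hs, Measure.snd_apply hs, ← univ_prod, hγ _ _ .univ hs, hm2 _ hs]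
    exact lintegral_mono fun y => mul_le_of_le_one_left' (hκ1 y)
  · have hν : ν univ + ν univ ≠ ∞ := by simp
    refine (ENNReal.add_le_add_iff_right hν).1 ?_
    calc μ univ + ρ univ + ∫⁻ p, edist p.1 p.2 ∂γ + (ν univ + ν univ)
        ≤ μ univ + ρ univ + (∫⁻ p, edist p.1 p.2 ∂π₁ + ∫⁻ p, edist p.1 p.2 ∂π₂)
          + (ν univ + ν univ) := by gcongr
      _ = (μ univ + ν univ + ∫⁻ p, edist p.1 p.2 ∂π₁) +
          (ν univ + ρ univ + ∫⁻ p, edist p.1 p.2 ∂π₂) := by ring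
      _ ≤ _ := add_le_add h3 h3'
      _ = 2 * (π₁ univ + π₂ univ) + (c + c') := by ring
      _ ≤ 2 * (γ univ + ν univ) + (c + c') := by gcongr
      _ = _ := by ring

end Near

/-! ### Cancellation of a common summand -/

section Cancel

variable {X : Type*} [MetricSpace X] [MeasurableSpace X] [SecondCountableTopology X]
  [BorelSpace X]

/-- The untransported fraction plus the transport cost per unit mass at `x`. -/
noncomputable def kernelCost (κ : Kernel X X) (x : X) : ℝ≥0∞ :=
  (1 - κ x univ) + ∫⁻ z, edist x z ∂κ x

lemma lintegral_kernelCost (α : Measure X) [IsFiniteMeasure α] {κ : Kernel X X}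
    [IsFiniteKernel κ] (hκ : ∀ x, κ x univ ≤ 1) :
    ∫⁻ x, kernelCost κ x ∂α + (α ⊗ₘ κ) univ = α univ + ∫⁻ p, edist p.1 p.2 ∂(α ⊗ₘ κ) := by
  have hu : (α ⊗ₘ κ) univ = ∫⁻ x, κ x univ ∂α := by
    rw [Measure.compProd_apply .univ]; simp
  have hm := κ.measurable_coe MeasurableSet.univ
  rw [hu, Measure.lintegral_compProd (by fun_prop)]
  unfold kernelCost
  rw [lintegral_add_left (f := fun x => 1 - κ x univ) (measurable_const.sub hm)]
  have h1 : α univ = ∫⁻ x, κ x univ ∂α + ∫⁻ x, (1 - κ x univ) ∂α := by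
    rw [← lintegral_add_left hm, ← lintegral_one]
    exact lintegral_congr fun x => (add_tsub_cancel_of_le (hκ x)).symm
  rw [h1]
  ring

lemma near_bind (μ : Measure X) [IsFiniteMeasure μ] {κ : Kernel X X} [IsFiniteKernel κ]
    (hκ : ∀ x, κ x univ ≤ 1) : Near μ (μ.bind κ) (∫⁻ x, kernelCost κ x ∂μ) := by
  refine ⟨μ ⊗ₘ κ, ?_, (Measure.snd_compProd μ κ).le, ?_⟩
  · refine Measure.le_iff.2 fun s hs => ?_
    rw [Measure.fst_apply hs, ← prod_univ, Measure.compProd_apply_prod hs .univ,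
      ← setLIntegral_one]
    exact lintegral_mono hκ
  · have e := lintegral_kernelCost μ hκ
    have hb : μ.bind κ univ = (μ ⊗ₘ κ) univ := by
      rw [← Measure.snd_compProd, Measure.snd_univ]
    rw [hb]
    refine le_of_eq ?_
    calc _ = (μ univ + ∫⁻ p, edist p.1 p.2 ∂(μ ⊗ₘ κ)) + (μ ⊗ₘ κ) univ := by ring
      _ = _ := by rw [← e]; ring

variable [StandardBorelSpace X]

/-- If a fraction `η` of the mass is stopped after each application of the kernel `κ`, then the
mass started from `p` is near the mass `o` that has been stopped so far together with the mass `x`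
still moving. Here `s` is the mass that has been moved so far, counted with multiplicity. -/
lemma exists_stopped_flow {p q r : Measure X} [IsFiniteMeasure p] [IsFiniteMeasure q]
    [IsFiniteMeasure r] {κ : Kernel X X} [IsFiniteKernel κ] (hκ : ∀ x, κ x univ ≤ 1)
    (hle : (p + r).bind κ ≤ q + r) (n : ℕ) :
    ∃ x o : Measure X, n * x univ ≤ (p + r) univ ∧ o ≤ q ∧ IsFiniteMeasure x ∧
      Near p (o + x) (∫⁻ y, kernelCost κ y ∂(p + r)) := by
  -- Of the mass arriving in `q + r`, the share `η` belonging to `q` stops, and the share `θ`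
  -- belonging to `r` is moved again.
  obtain ⟨η, θ, hη, hθ, hηθ, hq, hr⟩ := exists_density_add q r
  have hθη : ∀ x, θ x + η x = 1 := fun x => by rw [add_comm, hηθ]
  have hθ1 : ∀ x, θ x ≤ 1 := fun x => by rw [← hθη x]; exact le_self_add
  let T : Measure X → Measure X := fun m => (m.bind κ).withDensity θ
  let O : Measure X → Measure X := fun m => (m.bind κ).withDensity η
  have hTO : ∀ m, T m + O m = m.bind κ := fun m =>
    withDensity_add_of_add_eq_one _ hθ hθη
  have hTadd : ∀ m m', T (m + m') = T m + T m' := fun m m' => by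
    simp only [T, Measure.comp_add]; rw [withDensity_add_measure]
  have hOadd : ∀ m m', O (m + m') = O m + O m' := fun m m' => by
    simp only [O, Measure.comp_add]; rw [withDensity_add_measure]
  have hTle : ∀ m, m ≤ p + r → T m ≤ r := fun m hm => by
    calc T m ≤ (q + r).withDensity θ :=
          withDensity_mono_measure' ((bind_mono_measure hm κ).trans hle) θ
      _ = r := hr
  have hOle : ∀ m, m ≤ p + r → O m ≤ q := fun m hm => by
    calc O m ≤ (q + r).withDensity η :=
          withDensity_mono_measure' ((bind_mono_measure hm κ).trans hle) η
      _ = q := hq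
  have hTu : ∀ m, T m univ ≤ m univ := fun m => by
    refine le_trans ?_ (bind_univ_le m hκ)
    rw [← hTO m, Measure.add_apply]
    exact le_self_add
  -- Here `s = p + T p + ⋯ + Tⁿ⁻¹ p` and `x = Tⁿ p`. Since `T` sends measures below `p + r` below
  -- `r`, the bound `s ≤ p + r` persists, so the accumulated cost never exceeds one use of the plan.
  -- The masses of the `Tᵏ p` do not increase, whence `n * x univ ≤ s univ`.
  have key : ∀ n : ℕ, ∃ s x : Measure X, s + x = p + T s ∧ s ≤ p + r ∧ n * x univ ≤ s univ ∧
      IsFiniteMeasure x ∧ Near p (O s + x) (∫⁻ y, kernelCost κ y ∂s) := by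
    intro n
    induction n with
    | zero =>
      refine ⟨0, p, by simp [T], Measure.zero_le _, by simp, inferInstance, ?_⟩
      simpa [O] using Near.refl p
    | succ n ih =>
      obtain ⟨s, x, h1, h2, h3, h4, h5⟩ := ih
      have hs' : s + x ≤ p + r := h1 ▸ (by gcongr; exact hTle s h2)
      have : IsFiniteMeasure (O s) := isFiniteMeasure_of_le q (hOle s h2)
      refine ⟨s + x, T x, ?_, hs', ?_, ⟨(hTu x).trans_lt (measure_lt_top x _)⟩, ?_⟩
      · rw [hTadd, ← add_assoc, ← h1]
      · calc ((n + 1 : ℕ) : ℝ≥0∞) * T x univ ≤ (n + 1 : ℕ) * x univ := by exact mul_le_mul_right (hTu x) _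
          _ = n * x univ + x univ := by push_cast; ring
          _ ≤ s univ + x univ := by gcongr
          _ = _ := (Measure.add_apply _ _ _).symm
      · rw [lintegral_add_measure, hOadd]
        have := h5.trans ((Near.refl (O s)).add (near_bind x hκ))
        rw [← hTO x] at this
        convert this using 1
        · rw [add_assoc, add_comm (O x)]
        · rw [zero_add]
  obtain ⟨s, x, -, h2, h3, h4, h5⟩ := key n
  exact ⟨x, O s, h3.trans (h2 univ), hOle s h2, h4, h5.mono (lintegral_mono' h2 le_rfl)⟩

/-- Mass from `p` that the plan drops into `r` is sent on by the plan again, until it lands in `q`.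
All rounds together cost at most `c`, and after `n` rounds only a mass of order `1 / n` is still
moving; this remainder accounts for `ε`. -/
lemma Near.cancel {p q r : Measure X} [IsFiniteMeasure p] [IsFiniteMeasure q]
    [IsFiniteMeasure r] {c ε : ℝ≥0∞} (h : Near (p + r) (q + r) c) (hε : ε ≠ 0) :
    Near p q (3 * c + ε) := by
  rcases isEmpty_or_nonempty X with hX | hX
  · exact ⟨0, by simp, by simp, by simp [univ_eq_empty_iff.2 hX]⟩
  have hsymm := h.symm.univ_le
  obtain ⟨π, h1, h2, h3⟩ := h
  obtain ⟨κ, hfκ, hκ, rfl⟩ := exists_subkernel h1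
  have hπ : ((p + r) ⊗ₘ κ) univ ≤ (q + r) univ := by rw [← Measure.snd_univ]; exact h2 univ
  have hw : ∫⁻ y, kernelCost κ y ∂(p + r) ≤ c := by
    have e := lintegral_kernelCost (p + r) hκ
    set P := ((p + r) ⊗ₘ κ) univ
    have hP : 2 * P ≠ ∞ := ENNReal.mul_ne_top (by simp) (ne_top_of_le_ne_top (by simp) hπ)
    refine (ENNReal.add_le_add_iff_left hP).1 ?_
    calc 2 * P + ∫⁻ y, kernelCost κ y ∂(p + r)
        = (∫⁻ y, kernelCost κ y ∂(p + r) + P) + P := by ring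
      _ ≤ ((p + r) univ + ∫⁻ z, edist z.1 z.2 ∂((p + r) ⊗ₘ κ)) + (q + r) univ := by
        rw [e]; gcongr
      _ = (p + r) univ + (q + r) univ + ∫⁻ z, edist z.1 z.2 ∂((p + r) ⊗ₘ κ) := by ring
      _ ≤ _ := h3
  rw [Measure.snd_compProd] at h2
  have hqp : q univ ≤ p univ + c := by
    refine (ENNReal.add_le_add_iff_right (measure_ne_top r univ)).1 ?_
    simpa [add_right_comm] using hsymm
  rcases eq_or_ne c ∞ with rfl | hc
  · refine (near_of_univ_add p q).mono (by simp)
  obtain ⟨n, hn⟩ := ENNReal.exists_nat_mul_gt (a := ε / 2) (b := (p + r) univ) (by simpa using hε)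
    (measure_ne_top _ _)
  obtain ⟨x, o, hx, ho, hfx, hnear⟩ := exists_stopped_flow hκ h2 n
  have hxε : x univ ≤ ε / 2 := by
    by_contra! hlt
    exact absurd (hn.trans_le (mul_le_mul_right hlt.le (n : ℝ≥0∞))) (not_lt.2 hx)
  have hfo : IsFiniteMeasure o := isFiniteMeasure_of_le q ho
  replace hnear := hnear.mono hw
  have hpo := hnear.univ_le
  have hlast : Near (o + x) q ((q univ - o univ) + x univ) := by
    have := (near_of_le ho).add (near_of_univ_add x 0)
    simpa using this
  refine (hnear.trans hlast).mono ?_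
  -- One `c` compares the masses of `q` and `p`, the other those of `p` and `o + x`. With the `c` of
  -- the flow itself this makes 3.
  have : q univ - o univ ≤ 2 * c + x univ := by
    rw [tsub_le_iff_right]
    calc q univ ≤ p univ + c := hqp
      _ ≤ (o + x) univ + c + c := by gcongr
      _ = _ := by rw [Measure.add_apply]; ring
  calc c + (q univ - o univ + x univ) ≤ c + (2 * c + ε / 2 + ε / 2) := by
        gcongr; exact this.trans (by gcongr)
    _ = 3 * c + (ε / 2 + ε / 2) := by ring
    _ = _ := by rw [ENNReal.add_halves]

/-- Nearness of `p` and `q` depends only on the signed measure `p - q`, up to a constant. -/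
lemma Near.of_add_eq {p q p' q' : Measure X} [IsFiniteMeasure p] [IsFiniteMeasure q]
    [IsFiniteMeasure p'] [IsFiniteMeasure q'] {c ε : ℝ≥0∞} (h : Near p q c)
    (he : p + q' = p' + q) (hε : ε ≠ 0) : Near p' q' (3 * c + ε) := by
  refine Near.cancel (r := q) ?_ hε
  have := h.add (Near.refl q')
  rwa [he, add_zero, add_comm q q'] at this

end Cancel

/-! ### Cutting a plan into four blocks -/

section Split

variable {X : Type*} [MeasurableSpace X]

lemma fst_withDensity {Y : Type*} [MeasurableSpace Y] (π : Measure (X × Y)) {f : X → ℝ≥0∞}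
    (hf : Measurable f) : (π.withDensity fun p => f p.1).fst = π.fst.withDensity f := by
  ext s hs
  rw [Measure.fst_apply hs, withDensity_apply _ (measurable_fst hs), withDensity_apply _ hs,
    Measure.fst, setLIntegral_map hs hf measurable_fst]

lemma snd_withDensity {Y : Type*} [MeasurableSpace Y] (π : Measure (Y × X)) {f : X → ℝ≥0∞}
    (hf : Measurable f) : (π.withDensity fun p => f p.2).snd = π.snd.withDensity f := by
  ext s hs
  rw [Measure.snd_apply hs, withDensity_apply _ (measurable_snd hs), withDensity_apply _ hs,
    Measure.snd, setLIntegral_map hs hf measurable_snd]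

/-- Weight `π` at `(x, y)` by the shares of `P` and `N` at `x` times the shares of `M` and `Q` at
`y`; each pair of shares sums to 1. -/
lemma exists_split_plan {P N M Q : Measure X} [IsFiniteMeasure P] [IsFiniteMeasure N]
    [IsFiniteMeasure M] [IsFiniteMeasure Q] {π : Measure (X × X)} (h1 : π.fst ≤ P + N)
    (h2 : π.snd ≤ M + Q) :
    ∃ πPM πPQ πNM πNQ : Measure (X × X), π = πPM + πPQ + (πNM + πNQ) ∧
      (πPM + πPQ).fst ≤ P ∧ (πNM + πNQ).fst ≤ N ∧
      (πPM + πNM).snd ≤ M ∧ (πPQ + πNQ).snd ≤ Q := by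
  obtain ⟨u, u', hu, hu', huu, hP, hN⟩ := exists_density_add P N
  obtain ⟨v, v', hv, hv', hvv, hM, hQ⟩ := exists_density_add M Q
  let R : (X → ℝ≥0∞) → (X → ℝ≥0∞) → Measure (X × X) :=
    fun f g => π.withDensity fun p => f p.1 * g p.2
  have hfst : ∀ f, Measurable f → R f v + R f v' = π.withDensity fun p => f p.1 := fun f hf => by
    simp only [R]
    rw [← withDensity_add_left (by fun_prop)]
    congr 1; ext p
    simp [← mul_add, hvv]
  have hsnd : ∀ g, Measurable g → R u g + R u' g = π.withDensity fun p => g p.2 := fun g hg => by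
    simp only [R]
    rw [← withDensity_add_left (by fun_prop)]
    congr 1; ext p
    simp [← add_mul, huu]
  refine ⟨R u v, R u v', R u' v, R u' v', ?_, ?_, ?_, ?_, ?_⟩
  · rw [hfst u hu, hfst u' hu']
    exact (withDensity_add_of_add_eq_one π (hu.comp measurable_fst) fun p => huu p.1).symm
  · rw [hfst u hu, fst_withDensity π hu, ← hP]
    exact hP ▸ withDensity_mono_measure' h1 u
  · rw [hfst u' hu', fst_withDensity π hu', ← hN]
    exact hN ▸ withDensity_mono_measure' h1 u'
  · rw [hsnd v hv, snd_withDensity π hv, ← hM]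
    exact hM ▸ withDensity_mono_measure' h2 v
  · rw [hsnd v' hv', snd_withDensity π hv', ← hQ]
    exact hQ ▸ withDensity_mono_measure' h2 v'

variable [MetricSpace X]

/-- A partial plan from `P + N` to `M + Q` provides parts `mp` of `P` and `mm` of `M` that are near
`Q` and `N` while the remaining parts are near each other, up to the mass of a partial plan `ρ` from
`N` to `Q`. -/
lemma Near.exists_split {P N M Q : Measure X} [IsFiniteMeasure P] [IsFiniteMeasure N]
    [IsFiniteMeasure M] [IsFiniteMeasure Q] {c : ℝ≥0∞} (h : Near (P + N) (M + Q) c) :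
    ∃ (mp mm : Measure X) (ρ : Measure (X × X)), mp ≤ P ∧ mm ≤ M ∧
      mp univ ≤ Q univ ∧ mm univ ≤ N univ ∧
      ρ.fst ≤ N ∧ ρ.snd ≤ Q ∧ ∫⁻ p, edist p.1 p.2 ∂ρ ≤ c ∧
      Near (P - mp) (M - mm) c ∧ Near mp Q (c + ρ univ) ∧ Near N mm (c + ρ univ) := by
  obtain ⟨π, h1, h2, h3⟩ := h
  obtain ⟨πPM, πPQ, πNM, πNQ, rfl, hP, hN, hM, hQ⟩ := exists_split_plan h1 h2
  rw [Measure.fst_add] at hP hN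
  rw [Measure.snd_add] at hM hQ
  have hP' := hP univ
  have hN' := hN univ
  have hM' := hM univ
  have hQ' := hQ univ
  have hmp : πPQ.fst ≤ P := (Measure.le_add_left le_rfl).trans hP
  have hmm : πNM.snd ≤ M := (Measure.le_add_left le_rfl).trans hM
  have : IsFiniteMeasure πPQ.fst := isFiniteMeasure_of_le P hmp
  have : IsFiniteMeasure πNM.snd := isFiniteMeasure_of_le M hmm
  have hP0 : (P - πPQ.fst) + πPQ.fst = P := Measure.sub_add_cancel_of_le hmp
  have hM0 : (M - πNM.snd) + πNM.snd = M := Measure.sub_add_cancel_of_le hmm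
  have eP := congrArg (fun m : Measure X => m univ) hP0
  have eM := congrArg (fun m : Measure X => m univ) hM0
  simp only [Measure.add_apply, Measure.fst_univ, Measure.snd_univ, lintegral_add_measure]
    at hP' hN' hM' hQ' h3 eP eM
  have hPf := measure_ne_top P univ
  have hNf := measure_ne_top N univ
  have hMf := measure_ne_top M univ
  have hQf := measure_ne_top Q univ
  have hPQf : πPQ univ ≠ ∞ := ne_top_of_le_ne_top hQf (le_self_add.trans hQ')
  have hNMf : πNM univ ≠ ∞ := ne_top_of_le_ne_top hNf (le_self_add.trans hN')
  have hc : ∀ z ∈ ({∫⁻ p, edist p.1 p.2 ∂πPM, ∫⁻ p, edist p.1 p.2 ∂πPQ, ∫⁻ p, edist p.1 p.2 ∂πNM,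
      ∫⁻ p, edist p.1 p.2 ∂πNQ} : Set ℝ≥0∞), z ≤ ∫⁻ p, edist p.1 p.2 ∂πPM +
      ∫⁻ p, edist p.1 p.2 ∂πPQ + (∫⁻ p, edist p.1 p.2 ∂πNM + ∫⁻ p, edist p.1 p.2 ∂πNQ) := by
    rintro z (rfl | rfl | rfl | rfl)
    · exact le_self_add.trans le_self_add
    · exact le_add_self.trans le_self_add
    · exact le_self_add.trans le_add_self
    · exact le_add_self.trans le_add_self
  simp only [mem_insert_iff, mem_singleton_iff, forall_eq_or_imp, forall_eq] at hc
  obtain ⟨hcPM, hcPQ, hcNM, hcNQ⟩ := hc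
  refine ⟨πPQ.fst, πNM.snd, πNQ, hmp, hmm, ?_, ?_, (Measure.le_add_left le_rfl).trans hN,
    (Measure.le_add_left le_rfl).trans hQ, ?_, ⟨πPM, ?_, ?_, ?_⟩,
    ⟨πPQ, le_rfl, (Measure.le_add_right le_rfl).trans hQ, ?_⟩,
    ⟨πNM, (Measure.le_add_right le_rfl).trans hN, le_rfl, ?_⟩⟩
  · rw [Measure.fst_univ]; exact le_self_add.trans hQ'
  · rw [Measure.snd_univ]; exact le_self_add.trans hN'
  · refine hcNQ.trans ?_
    have hf : P univ + N univ + (M univ + Q univ) ≠ ∞ := by simp [*]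
    refine (ENNReal.add_le_add_iff_left hf).1 (h3.trans ?_)
    gcongr
    calc _ = (πPM univ + πPQ univ) + (πNM univ + πNQ univ) +
          ((πPM univ + πNM univ) + (πPQ univ + πNQ univ)) := by ring
      _ ≤ _ := add_le_add (add_le_add hP' hN') (add_le_add hM' hQ')
  · refine Measure.le_iff.2 fun s hs => ?_
    rw [Measure.sub_apply hs hmp]
    refine ENNReal.le_sub_of_add_le_right (measure_ne_top _ _) ?_
    rw [← Measure.add_apply]; exact hP s
  · refine Measure.le_iff.2 fun s hs => ?_
    rw [Measure.sub_apply hs hmm]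
    refine ENNReal.le_sub_of_add_le_right (measure_ne_top _ _) ?_
    rw [← Measure.add_apply]; exact hM s
  · have hf : πPQ univ + πNM univ + N univ + Q univ ≠ ∞ := by simp [*]
    refine (ENNReal.add_le_add_iff_right hf).1 ?_
    calc _ = ((P - πPQ.fst) univ + πPQ univ) + N univ +
          (((M - πNM.snd) univ + πNM univ) + Q univ) + ∫⁻ p, edist p.1 p.2 ∂πPM := by ring
      _ ≤ _ := by rw [eP, eM]; gcongr
      _ ≤ _ := h3
      _ = 2 * πPM univ + c + πPQ univ + πNM univ + (πNM univ + πNQ univ) +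
          (πPQ univ + πNQ univ) := by ring
      _ ≤ 2 * πPM univ + c + πPQ univ + πNM univ + N univ + Q univ := by gcongr
      _ = _ := by ring
  -- The part of `Q` not reached from `P` is either untouched, hence counted in `c`, or reached from
  -- `N`, hence counted in the mass of `πNQ`.
  · rw [Measure.fst_univ]
    have hf : P univ + N univ + M univ ≠ ∞ := by simp [*]
    refine (ENNReal.add_le_add_iff_right hf).1 ?_
    calc _ = πPQ univ +
          (P univ + N univ + (M univ + Q univ) + ∫⁻ p, edist p.1 p.2 ∂πPQ) := by ring
      _ ≤ _ := add_le_add le_rfl ((add_le_add le_rfl hcPQ).trans h3)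
      _ = 2 * πPQ univ + (c + πNQ univ) + (πPM univ + πPQ univ) + (πNM univ + πNQ univ) +
          (πPM univ + πNM univ) := by ring
      _ ≤ 2 * πPQ univ + (c + πNQ univ) + P univ + N univ + M univ := by gcongr
      _ = _ := by ring
  · rw [Measure.snd_univ]
    have hf : P univ + M univ + Q univ ≠ ∞ := by simp [*]
    refine (ENNReal.add_le_add_iff_right hf).1 ?_
    calc _ = πNM univ +
          (P univ + N univ + (M univ + Q univ) + ∫⁻ p, edist p.1 p.2 ∂πNM) := by ring
      _ ≤ _ := add_le_add le_rfl ((add_le_add le_rfl hcNM).trans h3)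
      _ = 2 * πNM univ + (c + πNQ univ) + (πPM univ + πPQ univ) + (πPM univ + πNM univ) +
          (πPQ univ + πNQ univ) := by ring
      _ ≤ 2 * πNM univ + (c + πNQ univ) + P univ + M univ + Q univ := by gcongr
      _ = _ := by ring

end Split

/-! ### Vanishing of plans between singular measures, and tightness -/

section Limits

variable {X : Type*} [MetricSpace X] [MeasurableSpace X] [SecondCountableTopology X]
  [BorelSpace X]

/-- Up to small mass, `N` and `Q` live on disjoint compact sets, which lie at positive distance. A
plan must then move all but a small mass over at least that distance, and Markov's inequality bounds
the moved mass by the cost. -/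
lemma tendsto_plan_univ_of_mutuallySingular [CompleteSpace X] {N Q : Measure X}
    [IsFiniteMeasure N]
    [IsFiniteMeasure Q] (hNQ : N ⟂ₘ Q) {ρ : ℕ → Measure (X × X)} {c : ℕ → ℝ≥0∞}
    (hN : ∀ n, (ρ n).fst ≤ N) (hQ : ∀ n, (ρ n).snd ≤ Q)
    (hc : ∀ n, ∫⁻ p, edist p.1 p.2 ∂ρ n ≤ c n) (hc0 : Tendsto c atTop (𝓝 0)) :
    Tendsto (fun n => ρ n univ) atTop (𝓝 0) := by
  obtain ⟨A, hA, hNA, hQA⟩ := hNQ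
  rw [ENNReal.tendsto_atTop_zero]
  intro ε hε
  have hε3 : ε / 3 ≠ 0 := by simpa using hε.ne'
  obtain ⟨K, hKA, hK, hKm⟩ := hA.compl.exists_isCompact_sdiff_lt (μ := N) (measure_ne_top _ _) hε3
  obtain ⟨L, hLA, hL, hLm⟩ := hA.exists_isCompact_sdiff_lt (μ := Q) (measure_ne_top _ _) hε3
  have hdisj : Disjoint K L := (disjoint_compl_left (a := A)).mono hKA hLA
  obtain ⟨r, hr, hrKL⟩ := Metric.exists_pos_forall_lt_edist hK hL.isClosed hdisj
  have hNK : N Kᶜ ≤ ε / 3 := by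
    have : Kᶜ ⊆ A ∪ (Aᶜ \ K) := fun x hx => by
      by_cases h : x ∈ A
      · exact Or.inl h
      · exact Or.inr ⟨h, hx⟩
    refine (measure_mono this).trans ((measure_union_le _ _).trans ?_)
    rw [hNA, zero_add]; exact hKm.le
  have hQL : Q Lᶜ ≤ ε / 3 := by
    have : Lᶜ ⊆ Aᶜ ∪ (A \ L) := fun x hx => by
      by_cases h : x ∈ A
      · exact Or.inr ⟨h, hx⟩
      · exact Or.inl h
    refine (measure_mono this).trans ((measure_union_le _ _).trans ?_)
    rw [hQA, zero_add]; exact hLm.le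
  have hr0 : (r : ℝ≥0∞) ≠ 0 := by exact_mod_cast hr.ne'
  have hpos : 0 < r * (ε / 3) := by
    exact pos_iff_ne_zero.2 (mul_ne_zero hr0 hε3)
  obtain ⟨n₀, hn₀⟩ := (ENNReal.tendsto_atTop_zero.1 hc0) _ hpos
  refine ⟨n₀, fun n hn => ?_⟩
  have hcover : (univ : Set (X × X)) ⊆
      Prod.fst ⁻¹' Kᶜ ∪ Prod.snd ⁻¹' Lᶜ ∪ {p | (r : ℝ≥0∞) ≤ edist p.1 p.2} := by
    rintro ⟨x, y⟩ -
    by_cases hx : x ∈ K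
    · by_cases hy : y ∈ L
      · exact Or.inr (hrKL x hx y hy).le
      · exact Or.inl (Or.inr hy)
    · exact Or.inl (Or.inl hx)
  have hmarkov : ρ n {p | (r : ℝ≥0∞) ≤ edist p.1 p.2} ≤ ε / 3 := by
    have := (mul_meas_ge_le_lintegral (μ := ρ n) (f := fun p : X × X => edist p.1 p.2)
      (by fun_prop) r).trans ((hc n).trans (hn₀ n hn))
    exact (ENNReal.mul_le_mul_iff_right hr0 ENNReal.coe_ne_top).1 this
  calc ρ n univ ≤ ρ n (Prod.fst ⁻¹' Kᶜ) + ρ n (Prod.snd ⁻¹' Lᶜ) +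
        ρ n {p | (r : ℝ≥0∞) ≤ edist p.1 p.2} :=
      (measure_mono hcover).trans ((measure_union_le _ _).trans
        (by gcongr; exact measure_union_le _ _))
    _ ≤ ε / 3 + ε / 3 + ε / 3 := by
      refine add_le_add (add_le_add ?_ ?_) hmarkov
      · rw [← Measure.fst_apply hK.isClosed.measurableSet.compl]
        exact (hN n _).trans hNK
      · rw [← Measure.snd_apply hL.isClosed.measurableSet.compl]
        exact (hQ n _).trans hQL
    _ = ε := ENNReal.add_thirds ε

/-- One `c` pays for the mass of `μ` outside the plan. The other pays, by Markov's inequality, for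
pairs at distance at least 1, among them all pairs leading from norm above `r + 1` to norm at most
`r`. -/
lemma Near.measure_le {E : Type*} [NormedAddCommGroup E] [MeasurableSpace E]
    [SecondCountableTopology E] [BorelSpace E] {μ ν : Measure E} [IsFiniteMeasure μ]
    [IsFiniteMeasure ν] {c : ℝ≥0∞} (h : Near μ ν c) (r : ℝ) :
    μ {x | r + 1 < ‖x‖} ≤ ν {x | r < ‖x‖} + (c + c) := by
  obtain ⟨π, h1, h2, h3⟩ := h
  have hπμ : π univ ≤ μ univ := by rw [← Measure.fst_univ]; exact h1 univ
  have hπν : π univ ≤ ν univ := by rw [← Measure.snd_univ]; exact h2 univ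
  have hπ : π univ ≠ ∞ := ne_top_of_le_ne_top (measure_ne_top μ _) hπμ
  have hcost : ∫⁻ p, edist p.1 p.2 ∂π ≤ c := by
    refine (ENNReal.add_le_add_iff_left (ENNReal.mul_ne_top ENNReal.ofNat_ne_top hπ)).1
      (le_trans ?_ h3)
    rw [two_mul]; gcongr
  have hμc : μ univ ≤ π univ + c := by
    refine (ENNReal.add_le_add_iff_right hπ).1 ?_
    calc μ univ + π univ ≤ μ univ + ν univ + ∫⁻ p, edist p.1 p.2 ∂π :=
          (add_le_add le_rfl hπν).trans le_self_add
      _ ≤ _ := h3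
      _ = _ := by ring
  set s := {x : E | r + 1 < ‖x‖}
  set t := {x : E | r < ‖x‖}
  have hs : MeasurableSet s := measurableSet_lt measurable_const measurable_norm
  have ht : MeasurableSet t := measurableSet_lt measurable_const measurable_norm
  have hμs : μ s ≤ π.fst s + c := by
    have hsc : π.fst sᶜ ≠ ∞ := ne_top_of_le_ne_top (measure_ne_top μ _) (h1 _)
    refine (ENNReal.add_le_add_iff_right hsc).1 ?_
    calc μ s + π.fst sᶜ ≤ μ s + μ sᶜ := by gcongr
      _ = μ univ := measure_add_measure_compl hs
      _ ≤ π univ + c := hμc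
      _ = π.fst s + π.fst sᶜ + c := by rw [measure_add_measure_compl hs, Measure.fst_univ]
      _ = _ := by ring
  have hcover : Prod.fst ⁻¹' s ⊆ Prod.snd ⁻¹' t ∪ {p : E × E | 1 ≤ edist p.1 p.2} := by
    rintro ⟨x, y⟩ hx
    by_cases hy : r < ‖y‖
    · exact Or.inl hy
    · refine Or.inr ?_
      have hx' : r + 1 < ‖x‖ := hx
      have : ‖x‖ ≤ ‖x - y‖ + ‖y‖ := by simpa using norm_add_le (x - y) y
      have h1 : (1 : ℝ) ≤ dist x y := by rw [dist_eq_norm]; linarith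
      show 1 ≤ edist x y
      rw [edist_dist, ← ENNReal.ofReal_one]
      exact ENNReal.ofReal_le_ofReal h1
  have hmarkov : π {p | 1 ≤ edist p.1 p.2} ≤ c := by
    have := (mul_meas_ge_le_lintegral (μ := π) (f := fun p : E × E => edist p.1 p.2)
      (by fun_prop) 1).trans hcost
    rwa [one_mul] at this
  calc μ s ≤ π.fst s + c := hμs
    _ ≤ (π.snd t + c) + c := by
      gcongr
      rw [Measure.fst_apply hs, Measure.snd_apply ht]
      exact (measure_mono hcover).trans ((measure_union_le _ _).trans (by gcongr))
    _ ≤ (ν t + c) + c := by gcongr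
    _ = _ := by ring

lemma isTightMeasureSet_range_of_near {E : Type*} [NormedAddCommGroup E] [MeasurableSpace E]
    [SecondCountableTopology E] [BorelSpace E] [ProperSpace E] {m : ℕ → Measure E}
    [∀ n, IsFiniteMeasure (m n)] {ν : Measure E} [IsFiniteMeasure ν] {c : ℕ → ℝ≥0∞}
    (h : ∀ n, Near (m n) ν (c n)) (hc : Tendsto c atTop (𝓝 0)) :
    IsTightMeasureSet (range m) := by
  refine isTightMeasureSet_range_of_tendsto_limsup_measure_norm_gt ?_
  have hν : Tendsto (fun r : ℝ => ν {x | r - 1 < ‖x‖}) atTop (𝓝 0) := by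
    have h0 : Tendsto (fun r : ℝ => ⨆ μ ∈ ({ν} : Set (Measure E)), μ {x | r < ‖x‖}) atTop (𝓝 0) :=
      tendsto_measure_norm_gt_of_isTightMeasureSet isTightMeasureSet_singleton
    simp only [iSup_singleton] at h0
    exact h0.comp (tendsto_atTop_add_const_right atTop (-1) tendsto_id)
  refine tendsto_of_tendsto_of_tendsto_of_le_of_le tendsto_const_nhds hν (fun _ => zero_le) ?_
  intro r
  have hle : ∀ n, m n {x | r < ‖x‖} ≤ ν {x | r - 1 < ‖x‖} + (c n + c n) := fun n => by
    simpa using (h n).measure_le (r - 1)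
  have hlim : Tendsto (fun n => ν {x | r - 1 < ‖x‖} + (c n + c n)) atTop
      (𝓝 (ν {x | r - 1 < ‖x‖})) := by
    simpa using tendsto_const_nhds.add (hc.add hc)
  exact (limsup_le_limsup (Eventually.of_forall hle)).trans hlim.limsup_eq.le

end Limits

/-! ### Nearness versus the generalized Wasserstein distance -/

section Comparison

variable {d : ℕ}

lemma add_jordanNeg_eq_of_eq_diff {σ : SignedMeasure (EuclideanSpace ℝ (Fin d))}
    {p q : FiniteMeasure (EuclideanSpace ℝ (Fin d))} (h : σ = diff p q) :
    (p : Measure (EuclideanSpace ℝ (Fin d))) + jordanNeg σ = jordanPos σ + q := by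
  have hσ : (jordanPos σ : Measure (EuclideanSpace ℝ (Fin d))).toSignedMeasure -
      (jordanNeg σ : Measure (EuclideanSpace ℝ (Fin d))).toSignedMeasure = σ :=
    SignedMeasure.toSignedMeasure_toJordanDecomposition σ
  rw [← Measure.toSignedMeasure_eq_toSignedMeasure_iff, Measure.toSignedMeasure_add,
    Measure.toSignedMeasure_add, ← sub_eq_sub_iff_add_eq_add, hσ, h]
  rfl

lemma diff_jordan (σ : SignedMeasure (EuclideanSpace ℝ (Fin d))) :
    diff (jordanPos σ) (jordanNeg σ) = σ :=
  SignedMeasure.toSignedMeasure_toJordanDecomposition σ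

lemma diff_add_diff (p q p' q' : FiniteMeasure (EuclideanSpace ℝ (Fin d))) :
    diff p q - diff p' q' = diff (p + q') (q + p') := by
  simp only [diff, FiniteMeasure.toMeasure_add, Measure.toSignedMeasure_add]
  abel

lemma normab_eq (a b : ℝ) (σ : SignedMeasure (EuclideanSpace ℝ (Fin d))) :
    normab a b σ = W1ab a b (jordanPos σ) (jordanNeg σ) := by
  have h1 : jordanPos (0 : SignedMeasure (EuclideanSpace ℝ (Fin d))) = 0 := by
    apply Subtype.ext
    simp [jordanPos, SignedMeasure.toJordanDecomposition_zero]
  have h2 : jordanNeg (0 : SignedMeasure (EuclideanSpace ℝ (Fin d))) = 0 := by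
    apply Subtype.ext
    simp [jordanNeg, SignedMeasure.toJordanDecomposition_zero]
  rw [normab, signedW1ab, h1, h2, add_zero, add_zero]

lemma tvMass_diff_of_le {μ ν : FiniteMeasure (EuclideanSpace ℝ (Fin d))}
    (h : (ν : Measure (EuclideanSpace ℝ (Fin d))) ≤ μ) :
    tvMass (diff μ ν) = (μ : Measure (EuclideanSpace ℝ (Fin d))) univ -
      (ν : Measure (EuclideanSpace ℝ (Fin d))) univ := by
  rw [tvMass, diff, SignedMeasure.totalVariation,
    Measure.toJordanDecomposition_toSignedMeasure_sub,
    Measure.jordanDecompositionOfToSignedMeasureSub_posPart,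
    Measure.jordanDecompositionOfToSignedMeasureSub_negPart, Measure.sub_eq_zero_of_le h,
    add_zero, Measure.sub_apply .univ h]

/-- The Jordan parts of the difference are near by the zero plan; cancellation carries this over to
`μ` and `ν`. -/
lemma near_tvMass_diff (μ ν : FiniteMeasure (EuclideanSpace ℝ (Fin d))) {ε : ℝ≥0∞} (hε : ε ≠ 0) :
    Near (μ : Measure (EuclideanSpace ℝ (Fin d))) ν (3 * tvMass (diff μ ν) + ε) :=
  (near_of_univ_add (jordanPos (diff μ ν) : Measure (EuclideanSpace ℝ (Fin d)))
    (jordanNeg (diff μ ν))).of_add_eq (add_jordanNeg_eq_of_eq_diff rfl).symm hε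

/-- The marginals of the partial plan serve as the competitors `μ'` and `ν'`. -/
lemma W1ab_le_of_near (a b : ℝ) {μ ν : FiniteMeasure (EuclideanSpace ℝ (Fin d))} {c : ℝ≥0∞}
    (h : Near (μ : Measure (EuclideanSpace ℝ (Fin d))) ν c) :
    W1ab a b μ ν ≤ (ENNReal.ofReal a + ENNReal.ofReal b) * c := by
  obtain ⟨π, h1, h2, h3⟩ := h
  have hf1 : IsFiniteMeasure π.fst := isFiniteMeasure_of_le _ h1
  have hf2 : IsFiniteMeasure π.snd := isFiniteMeasure_of_le _ h2
  let μ' : FiniteMeasure (EuclideanSpace ℝ (Fin d)) := ⟨π.fst, hf1⟩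
  let ν' : FiniteMeasure (EuclideanSpace ℝ (Fin d)) := ⟨π.snd, hf2⟩
  have hπμ : π univ ≤ (μ : Measure (EuclideanSpace ℝ (Fin d))) univ := by
    rw [← Measure.fst_univ]; exact h1 univ
  have hπν : π univ ≤ (ν : Measure (EuclideanSpace ℝ (Fin d))) univ := by
    rw [← Measure.snd_univ]; exact h2 univ
  have hπ : π univ ≠ ∞ := ne_top_of_le_ne_top (measure_ne_top _ _) hπμ
  have hmass : μ'.mass = ν'.mass := by
    rw [← ENNReal.coe_inj, FiniteMeasure.ennreal_mass, FiniteMeasure.ennreal_mass]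
    exact Measure.fst_univ.trans Measure.snd_univ.symm
  have e1 : tvMass (diff μ μ') = (μ : Measure (EuclideanSpace ℝ (Fin d))) univ - π univ := by
    rw [tvMass_diff_of_le h1, ← Measure.fst_univ]; rfl
  have e2 : tvMass (diff ν ν') = (ν : Measure (EuclideanSpace ℝ (Fin d))) univ - π univ := by
    rw [tvMass_diff_of_le h2, ← Measure.snd_univ]; rfl
  have hW : W1 μ' ν' ≤ ∫⁻ p, edist p.1 p.2 ∂π := iInf₂_le π ⟨rfl, rfl⟩
  have hc : ((μ : Measure (EuclideanSpace ℝ (Fin d))) univ - π univ) +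
      ((ν : Measure (EuclideanSpace ℝ (Fin d))) univ - π univ) +
      ∫⁻ p, edist p.1 p.2 ∂π ≤ c := by
    have h2π : 2 * π univ ≠ ∞ := ENNReal.mul_ne_top ENNReal.ofNat_ne_top hπ
    refine (ENNReal.add_le_add_iff_left h2π).1 (le_trans (le_of_eq ?_) h3)
    rw [← add_tsub_cancel_of_le hπμ, ← add_tsub_cancel_of_le hπν,
      ENNReal.add_sub_cancel_left hπ, ENNReal.add_sub_cancel_left hπ]
    ring
  refine (iInf₂_le μ' ν').trans ((iInf_le _ hmass).trans ?_)
  rw [e1, e2, add_mul]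
  gcongr
  · exact le_self_add.trans hc
  · exact hW.trans (le_add_self.trans hc)

/-- The competitors `μ'`, `ν'` need not lie below `μ`, `ν`, so their plan is not a partial plan. The
chain `μ`, `μ'`, `ν'`, `ν` repairs this; the summand 2 comes from taking `ε = c` in both total
variation steps. -/
lemma near_of_W1ab_lt {a b : ℝ} (ha : 0 < a) (hb : 0 < b)
    {μ ν : FiniteMeasure (EuclideanSpace ℝ (Fin d))} {c : ℝ≥0∞} (h : W1ab a b μ ν < c) :
    Near (μ : Measure (EuclideanSpace ℝ (Fin d))) ν
      ((3 * (ENNReal.ofReal a)⁻¹ + (ENNReal.ofReal b)⁻¹ + 2) * c) := by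
  have ha0 : ENNReal.ofReal a ≠ 0 := by simpa using ha
  have hb0 : ENNReal.ofReal b ≠ 0 := by simpa using hb
  simp only [W1ab, iInf_lt_iff] at h
  obtain ⟨μ', ν', hmass, h⟩ := h
  have hc0 : c ≠ 0 := (zero_le.trans_lt h).ne'
  have ht : tvMass (diff μ μ') + tvMass (diff ν ν') ≤ (ENNReal.ofReal a)⁻¹ * c := by
    rw [← ENNReal.mul_le_iff_le_inv ha0 ENNReal.ofReal_ne_top]
    exact le_self_add.trans h.le
  have hW : W1 μ' ν' < (ENNReal.ofReal b)⁻¹ * c := by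
    rw [mul_comm, ← div_eq_mul_inv,
      ENNReal.lt_div_iff_mul_lt (Or.inl hb0) (Or.inl ENNReal.ofReal_ne_top), mul_comm]
    exact le_add_self.trans_lt h
  simp only [W1, iInf_lt_iff] at hW
  obtain ⟨π, ⟨hπ1, hπ2⟩, hπ⟩ := hW
  have hnear : Near (μ' : Measure (EuclideanSpace ℝ (Fin d))) ν' ((ENNReal.ofReal b)⁻¹ * c) := by
    refine ⟨π, hπ1.le, hπ2.le, ?_⟩
    rw [← hπ1, ← hπ2, Measure.fst_univ, Measure.snd_univ, two_mul]
    gcongr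
  refine (((near_tvMass_diff μ μ' hc0).trans hnear).trans
    (near_tvMass_diff ν ν' hc0).symm).mono ?_
  calc _ = 3 * (tvMass (diff μ μ') + tvMass (diff ν ν')) + (ENNReal.ofReal b)⁻¹ * c + 2 * c := by
        ring
    _ ≤ 3 * ((ENNReal.ofReal a)⁻¹ * c) + (ENNReal.ofReal b)⁻¹ * c + 2 * c := by gcongr
    _ = _ := by ring

/-- Convergence to zero of the generalized Wasserstein distance, in terms of partial plans. -/
lemma tendsto_W1ab_iff {a b : ℝ} (ha : 0 < a) (hb : 0 < b)
    {μ ν : ℕ → FiniteMeasure (EuclideanSpace ℝ (Fin d))} :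
    Tendsto (fun n => W1ab a b (μ n) (ν n)) atTop (𝓝 0) ↔
      ∃ c : ℕ → ℝ≥0∞, Tendsto c atTop (𝓝 0) ∧
        ∀ n, Near (μ n : Measure (EuclideanSpace ℝ (Fin d))) (ν n) (c n) := by
  constructor
  · intro h
    set K := 3 * (ENNReal.ofReal a)⁻¹ + (ENNReal.ofReal b)⁻¹ + 2
    have hK : K ≠ ∞ := by
      simp [K, ENNReal.mul_eq_top, ha, hb]
    -- The added `1 / n` gives the strict inequality needed to select a plan; at `n = 0` it is `∞`,
    -- which does not affect the limit.
    refine ⟨fun n => K * (W1ab a b (μ n) (ν n) + (n : ℝ≥0∞)⁻¹), ?_, fun n => ?_⟩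
    · simpa using ENNReal.Tendsto.const_mul (h.add ENNReal.tendsto_inv_nat_nhds_zero)
        (Or.inr hK)
    · rcases eq_or_ne (W1ab a b (μ n) (ν n)) ∞ with he | he
      · refine (near_of_univ_add _ _).mono ?_
        have hK0 : K ≠ 0 := by simp [K]
        simp [he, ENNReal.mul_top hK0]
      · exact near_of_W1ab_lt ha hb (ENNReal.lt_add_right he (by simp))
  · rintro ⟨c, hc, h⟩
    have hlim : Tendsto (fun n => (ENNReal.ofReal a + ENNReal.ofReal b) * c n) atTop (𝓝 0) := by
      simpa using ENNReal.Tendsto.const_mul hc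
        (Or.inr (ENNReal.add_ne_top.2 ⟨ENNReal.ofReal_ne_top, ENNReal.ofReal_ne_top⟩))
    exact tendsto_of_tendsto_of_tendsto_of_le_of_le tendsto_const_nhds hlim (fun _ => zero_le)
      fun n => W1ab_le_of_near a b (h n)

/-- The generalized Wasserstein norm can be computed, as far as convergence to zero is concerned,
with any decomposition into positive measures. -/
lemma tendsto_normab_iff {a b : ℝ} (ha : 0 < a) (hb : 0 < b)
    {σ : ℕ → SignedMeasure (EuclideanSpace ℝ (Fin d))}
    {p q : ℕ → FiniteMeasure (EuclideanSpace ℝ (Fin d))} (h : ∀ n, σ n = diff (p n) (q n)) :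
    Tendsto (fun n => normab a b (σ n)) atTop (𝓝 0) ↔
      Tendsto (fun n => W1ab a b (p n) (q n)) atTop (𝓝 0) := by
  have key : ∀ {p q p' q' : ℕ → FiniteMeasure (EuclideanSpace ℝ (Fin d))},
      (∀ n, (p n : Measure (EuclideanSpace ℝ (Fin d))) + q' n = p' n + q n) →
      Tendsto (fun n => W1ab a b (p n) (q n)) atTop (𝓝 0) →
      Tendsto (fun n => W1ab a b (p' n) (q' n)) atTop (𝓝 0) := by
    intro p q p' q' he ht
    obtain ⟨c, hc, hn⟩ := (tendsto_W1ab_iff ha hb).1 ht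
    refine (tendsto_W1ab_iff ha hb).2 ⟨fun n => 3 * c n + (n : ℝ≥0∞)⁻¹, ?_, fun n =>
      (hn n).of_add_eq (he n) (by simp)⟩
    simpa using (ENNReal.Tendsto.const_mul hc (Or.inr ENNReal.ofNat_ne_top)).add
      ENNReal.tendsto_inv_nat_nhds_zero
  simp only [normab_eq]
  exact ⟨key fun n => (add_jordanNeg_eq_of_eq_diff (h n)).symm,
    key fun n => add_jordanNeg_eq_of_eq_diff (h n)⟩

end Comparison

end GenWasserstein

open GenWasserstein in
theorem theorem30 {d : ℕ} (a b : ℝ) (ha : 0 < a) (hb : 0 < b)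
    (μs : ℕ → SignedMeasure (EuclideanSpace ℝ (Fin d)))
    (μ : SignedMeasure (EuclideanSpace ℝ (Fin d)))
    (μp μm : ℕ → FiniteMeasure (EuclideanSpace ℝ (Fin d)))
    (hdec : ∀ n, μs n = GenWasserstein.diff (μp n) (μm n)) :
    Tendsto (fun n => GenWasserstein.normab a b (μs n - μ)) atTop (𝓝 0) ↔
      ∃ zp zm mp mm : ℕ → FiniteMeasure (EuclideanSpace ℝ (Fin d)),
        (∀ n, μp n = zp n + mp n) ∧
        (∀ n, μm n = zm n + mm n) ∧
        Tendsto (fun n => GenWasserstein.W1ab a b (zp n) (zm n)) atTop (𝓝 0) ∧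
        Tendsto (fun n => GenWasserstein.W1ab a b (mp n) (GenWasserstein.jordanPos μ))
          atTop (𝓝 0) ∧
        Tendsto (fun n => GenWasserstein.W1ab a b (mm n) (GenWasserstein.jordanNeg μ))
          atTop (𝓝 0) ∧
        GenWasserstein.IsTightSeq mp ∧ GenWasserstein.IsTightSeq mm ∧
        GenWasserstein.IsBoundedInMass mp ∧ GenWasserstein.IsBoundedInMass mm := by
  -- These two positive measures are in general not the Jordan parts of `μₙ - μ`; this is where
  -- independence of the decomposition enters.
  have hσ : ∀ n, μs n - μ = diff (μp n + jordanNeg μ) (μm n + jordanPos μ) := fun n => by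
    rw [← diff_add_diff, ← hdec, diff_jordan]
  rw [tendsto_normab_iff ha hb hσ, tendsto_W1ab_iff ha hb]
  constructor
  · rintro ⟨c, hc, hnear⟩
    simp only [FiniteMeasure.toMeasure_add] at hnear
    choose mp mm ρ hmp hmm hmpb hmmb hρN hρQ hρc hz hmpQ hmmN using fun n => (hnear n).exists_split
    have hρ : Tendsto (fun n => ρ n Set.univ) atTop (𝓝 0) :=
      tendsto_plan_univ_of_mutuallySingular μ.toJordanDecomposition.mutuallySingular.symm
        hρN hρQ hρc hc
    have hc' : Tendsto (fun n => c n + ρ n Set.univ) atTop (𝓝 0) := by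
      simpa using hc.add hρ
    have hfp : ∀ n, IsFiniteMeasure (mp n) := fun n => isFiniteMeasure_of_le _ (hmp n)
    have hfm : ∀ n, IsFiniteMeasure (mm n) := fun n => isFiniteMeasure_of_le _ (hmm n)
    have hbound : ∀ {m : ℕ → FiniteMeasure (EuclideanSpace ℝ (Fin d))}
        {ν : FiniteMeasure (EuclideanSpace ℝ (Fin d))},
        (∀ n, (m n : Measure (EuclideanSpace ℝ (Fin d))) Set.univ ≤
          (ν : Measure (EuclideanSpace ℝ (Fin d))) Set.univ) → IsBoundedInMass m := by
      intro m ν h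
      refine ⟨ν.mass, fun n => ?_⟩
      rw [← ENNReal.coe_le_coe, FiniteMeasure.ennreal_mass, FiniteMeasure.ennreal_mass]
      exact h n
    refine ⟨fun n => ⟨μp n - mp n, inferInstance⟩, fun n => ⟨μm n - mm n, inferInstance⟩,
      fun n => ⟨mp n, hfp n⟩, fun n => ⟨mm n, hfm n⟩,
      fun n => Subtype.ext (Measure.sub_add_cancel_of_le (hmp n)).symm,
      fun n => Subtype.ext (Measure.sub_add_cancel_of_le (hmm n)).symm,
      (tendsto_W1ab_iff ha hb).2 ⟨c, hc, hz⟩,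
      (tendsto_W1ab_iff ha hb).2 ⟨_, hc', hmpQ⟩,
      (tendsto_W1ab_iff ha hb).2 ⟨_, hc', fun n => (hmmN n).symm⟩,
      isTightMeasureSet_range_of_near (m := mp) hmpQ hc',
      isTightMeasureSet_range_of_near (m := mm) (fun n => (hmmN n).symm) hc',
      hbound (ν := jordanPos μ) hmpb, hbound (ν := jordanNeg μ) hmmb⟩
  · rintro ⟨zp, zm, mp, mm, hp, hm, hz, hmp, hmm, -, -, -, -⟩
    obtain ⟨c₁, hc₁, h₁⟩ := (tendsto_W1ab_iff ha hb).1 hz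
    obtain ⟨c₂, hc₂, h₂⟩ := (tendsto_W1ab_iff ha hb).1 hmp
    obtain ⟨c₃, hc₃, h₃⟩ := (tendsto_W1ab_iff ha hb).1 hmm
    refine ⟨fun n => c₁ n + c₂ n + c₃ n, by simpa using (hc₁.add hc₂).add hc₃, fun n => ?_⟩
    -- The third plan is reversed so that `μ⁻` stands on the source side and `mₙ⁻` on the target
    -- side.
    have := ((h₁ n).add (h₂ n)).add (h₃ n).symm
    rw [hp, hm]
    simp only [FiniteMeasure.toMeasure_add]
    rwa [add_right_comm (zm n : Measure (EuclideanSpace ℝ (Fin d)))] at this
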